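/- Let $X\subset\mathbb R^n$ be compact with positive Lebesgue measure, let $k\ge 1$ be an integer and let $f\in C^k(X)$, i.e. $f$ is the restriction to $X$ of a $C^k$ function on an open neighbourhood of $X$. For a polynomial $p$ on $\mathbb R^n$ and $d\in\mathbb N$ let $\mu_p$ be the image of Lebesgue measure on $X$ under $x\mapsto (x,p(x))$, let $$\Lambda_{p,d}(x,y)=\inf\Big\{\int P^2\,d\mu_p \;:\; P\in\mathbb R[x_1,\dots,x_n,y],\ \deg P\le d,\ P(x,y)=1\Big\}$$ be its Christoffel function of degree $d$, and let $q_d(x)=q_{p,d}(x)=\operatorname{argmax}_{y\in\mathbb R}\Lambda_{p,d}(x,y)$ (the least maximiser if there are several) be the Christoffel--Darboux approximant induced by the graph of $p$. Then there is a constant $C>0$, depending only on $n$, $X$, $k$ and $f$, such that for every integer $s\ge 1$ there are a polynomial $p$ of total degree at most $s$ with $\sup_{X}|f-p|\le C s^{-k}$ and a degree $d$ such that, for every $x\in X$, the function $y\mapsto\Lambda_{p,d}(x,y)$ has exactly one global maximiser on $\mathbb R$, namely $q_d(x)$, and $$\|f-q_d\|_\infty=\sup_{x\in X}|f(x)-q_d(x)|\le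 C\,s^{-k}.$$ -/

import Mathlib

open MeasureTheory

noncomputable section

/-- `f` is of class `C^k` on the (compact) set `X`: it is the restriction to `X` of a `C^k` function
defined on some open neighbourhood of `X`. -/
def IsCkOn {n : ℕ} (k : ℕ) (f : EuclideanSpace ℝ (Fin n) → ℝ)
    (X : Set (EuclideanSpace ℝ (Fin n))) : Prop :=
  ∃ (U : Set (EuclideanSpace ℝ (Fin n))) (F : EuclideanSpace ℝ (Fin n) → ℝ),
    IsOpen U ∧ X ⊆ U ∧ ContDiffOn ℝ (k : WithTop ℕ∞) F U ∧ Set.EqOn f F X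

/-- The value at `(x, y) ∈ ℝⁿ × ℝ` of a polynomial in `n + 1` variables, the last one being `y`. -/
def evalPair {n : ℕ} (P : MvPolynomial (Fin (n + 1)) ℝ) (z : EuclideanSpace ℝ (Fin n) × ℝ) : ℝ :=
  MvPolynomial.eval (Fin.snoc (α := fun _ => ℝ) z.1.ofLp z.2) P

/-- The function on `ℝⁿ` given by a polynomial in `n` variables. -/
def polyFun {n : ℕ} (p : MvPolynomial (Fin n) ℝ) (x : EuclideanSpace ℝ (Fin n)) : ℝ :=
  MvPolynomial.eval x.ofLp p

/-- The degenerate measure `dμ(x, y) = 1_X(x) dx δ_{g(x)}(dy)` carried by the graph of `g` over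
`X`. -/
def graphMeasure {n : ℕ} (X : Set (EuclideanSpace ℝ (Fin n))) (g : EuclideanSpace ℝ (Fin n) → ℝ) :
    Measure (EuclideanSpace ℝ (Fin n) × ℝ) :=
  (volume.restrict X).map (fun x => (x, g x))

/-- The Christoffel function of degree `d` of a measure `μ` on `ℝⁿ × ℝ`:
the infimum of `∫ P² dμ` over the polynomials `P` of total degree at most `d` with `P z = 1`. -/
def christoffel {n : ℕ} (μ : Measure (EuclideanSpace ℝ (Fin n) × ℝ)) (d : ℕ)
    (z : EuclideanSpace ℝ (Fin n) × ℝ) : ℝ :=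
  sInf {r : ℝ | ∃ P : MvPolynomial (Fin (n + 1)) ℝ,
    P.totalDegree ≤ d ∧ evalPair P z = 1 ∧ r = ∫ w, (evalPair P w) ^ 2 ∂μ}

/-- The set of global maximisers of `y ↦ Λ_d(x, y)` on the real line (that is, of global minimisers
of the inverse of the Christoffel function), for the graph measure of `g` over `X`. -/
def cdArgmax {n : ℕ} (X : Set (EuclideanSpace ℝ (Fin n))) (g : EuclideanSpace ℝ (Fin n) → ℝ)
    (d : ℕ) (x : EuclideanSpace ℝ (Fin n)) : Set ℝ :=
  {y : ℝ | ∀ y' : ℝ,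
    christoffel (graphMeasure X g) d (x, y') ≤ christoffel (graphMeasure X g) d (x, y)}

/-- The Christoffel-Darboux approximant `q_d` of degree `d` induced by the graph of `g` over `X`:
at `x` it takes the (least) maximiser of `y ↦ Λ_d(x, y)`. -/
def cdApprox {n : ℕ} (X : Set (EuclideanSpace ℝ (Fin n))) (g : EuclideanSpace ℝ (Fin n) → ℝ)
    (d : ℕ) (x : EuclideanSpace ℝ (Fin n)) : ℝ :=
  sInf (cdArgmax X g d x)

end

/-!
The Christoffel function of the graph of a polynomial `p` recovers `p` exactly. If `deg p ≤ d` and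
`1 ≤ d`, the polynomial `y - p(x)` is admissible and vanishes on the graph, so suitable multiples of
it show that `Λ_d(x, y) = 0` off the graph. On the graph `Λ_d(x, p(x))` is positive: substituting
`y = p(x)` turns the competitors into polynomials in `x` of bounded degree, on which
`q ↦ ∫_X q²` is positive definite because a nonzero polynomial vanishes only on a null set and `X`
has positive measure; in finite dimension it therefore dominates a multiple of `q(x)²`
(`exists_sq_polyFun_le`). Hence `p(x)` is the only maximiser (`cdArgmax_polyFun`), and the claim,
with `d = s`, reduces to a multivariate Jackson theorem: a function of class `C^k` near a compact set
is approximated there by polynomials of degree `s` with error `O(s^{-k})`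
(`IsCkOn.exists_polyFun_approx`).

For the Jackson theorem, extend `f` to a compactly supported `C^k` function `F`, and average
translates of `F` against a radial polynomial kernel `t ↦ W(‖t‖²)` on a ball:
`∑_{j=1}^k (-1)^{j+1} (k choose j) ∫ F(x + j t) W(‖t‖²) dt`. A change of variables shows that each
term is a polynomial in `x` on `X`, since the integrand vanishes off the ball. The difference to
`F(x)` is, up to sign, the integral of the `k`-th forward difference of `F` with step `t`, which is
at most `sup ‖D^k F‖ ‖t‖^k` (`norm_fwdDiff_iter_le`). What remains is a nonnegative kernel of mass
one, of degree at most `s` and with `k`-th moment `O(s^{-k})` (`exists_radial_kernel`). It is a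
normalised power of the Fejér-type polynomial `Q` with `Q(sin² θ) = (sin mθ / (m sin θ))²`, which
decays like `(1 + m u)⁻²` at `u² = sin² θ`.
-/

/-! ### Zeros of multivariate polynomials -/

/-- By Fubini: for almost every choice of the last `n` coordinates some coefficient with respect to
the first coordinate survives, and then only finitely many values of that coordinate are zeros. -/
lemma MvPolynomial.ae_eval_ne_zero {n : ℕ} {p : MvPolynomial (Fin n) ℝ} (hp : p ≠ 0) :
    ∀ᵐ x : Fin n → ℝ, MvPolynomial.eval x p ≠ 0 := by
  induction n with
  | zero =>
    refine ae_of_all _ fun x h => hp ?_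
    rw [MvPolynomial.eq_C_of_isEmpty p] at h ⊢
    simpa using h
  | succ n ih =>
    have hq : MvPolynomial.finSuccEquiv ℝ n p ≠ 0 := by simpa using hp
    obtain ⟨i, hi⟩ : ∃ i, (MvPolynomial.finSuccEquiv ℝ n p).coeff i ≠ 0 := by
      by_contra! h
      exact hq (Polynomial.ext (by simpa using h))
    have key : ∀ᵐ z : ℝ × (Fin n → ℝ), MvPolynomial.eval (Fin.cons z.1 z.2) p ≠ 0 := by
      have hmeas : MeasurableSet
          {z : (Fin n → ℝ) × ℝ | MvPolynomial.eval (Fin.cons z.2 z.1 : Fin (n + 1) → ℝ) p ≠ 0} := by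
        have hc : Continuous fun z : (Fin n → ℝ) × ℝ =>
            MvPolynomial.eval (Fin.cons z.2 z.1 : Fin (n + 1) → ℝ) p :=
          p.continuous_eval.comp
            (Continuous.finCons (A := fun _ => ℝ) continuous_snd continuous_fst)
        exact (isOpen_ne.preimage hc).measurableSet
      have h1 : ∀ᵐ z : (Fin n → ℝ) × ℝ,
          MvPolynomial.eval (Fin.cons z.2 z.1 : Fin (n + 1) → ℝ) p ≠ 0 := by
        refine (Measure.ae_prod_iff_ae_ae hmeas).2 ?_
        filter_upwards [ih hi] with x hx
        have hne : ((MvPolynomial.finSuccEquiv ℝ n p).map (MvPolynomial.eval x)) ≠ 0 := by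
          intro h0
          apply hx
          rw [← Polynomial.coeff_map, h0, Polynomial.coeff_zero]
        have hfin := (Polynomial.finite_setOfPred_isRoot hne)
        filter_upwards [hfin.countable.ae_notMem volume] with y hy
        rw [MvPolynomial.eval_eq_eval_mv_eval']
        exact hy
      exact (Measure.measurePreserving_swap (μ := (volume : Measure ℝ))
        (ν := (volume : Measure (Fin n → ℝ)))).quasiMeasurePreserving.ae h1
    have h2 := (volume_preserving_piFinSuccAbove (fun _ : Fin (n + 1) => ℝ)
      0).quasiMeasurePreserving.ae key
    filter_upwards [h2] with x hx
    have : (Fin.cons ((MeasurableEquiv.piFinSuccAbove (fun _ : Fin (n + 1) => ℝ) 0) x).1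
        ((MeasurableEquiv.piFinSuccAbove (fun _ : Fin (n + 1) => ℝ) 0) x).2 :
        Fin (n + 1) → ℝ) = x := by
      ext j
      refine Fin.cases ?_ (fun j => ?_) j <;>
        simp [MeasurableEquiv.piFinSuccAbove, Fin.insertNthEquiv, Fin.tail]
    rwa [this] at hx

lemma continuous_polyFun {n : ℕ} (p : MvPolynomial (Fin n) ℝ) : Continuous (polyFun p) :=
  p.continuous_eval.comp (PiLp.continuous_ofLp 2 _)

lemma ae_polyFun_ne_zero {n : ℕ} {p : MvPolynomial (Fin n) ℝ} (hp : p ≠ 0) :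
    ∀ᵐ x, polyFun p x ≠ 0 :=
  (PiLp.volume_preserving_ofLp (Fin n)).quasiMeasurePreserving.ae
    (MvPolynomial.ae_eval_ne_zero hp)

/-! ### Positive definiteness of the `L²` form on polynomials -/

lemma memLp_polyFun {n : ℕ} {X : Set (EuclideanSpace ℝ (Fin n))} (hX : IsCompact X)
    (p : MvPolynomial (Fin n) ℝ) : MemLp (polyFun p) 2 (volume.restrict X) :=
  (memLp_two_iff_integrable_sq (continuous_polyFun p).aestronglyMeasurable).2
    (((continuous_polyFun p).pow 2).continuousOn.integrableOn_compact hX)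

/-- The class in `L²(X)` of the function given by a polynomial, as a linear map. -/
noncomputable def polyToLp {n : ℕ} {X : Set (EuclideanSpace ℝ (Fin n))} (hX : IsCompact X) :
    MvPolynomial (Fin n) ℝ →ₗ[ℝ] Lp ℝ 2 (volume.restrict X) where
  toFun p := (memLp_polyFun hX p).toLp (polyFun p)
  map_add' p q := by
    rw [← MemLp.toLp_add]; congr 1; ext x; simp [polyFun]
  map_smul' c p := by
    rw [RingHom.id_apply, ← MemLp.toLp_const_smul]; congr 1; ext x
    simp [polyFun, MvPolynomial.smul_eval]

lemma polyToLp_injective {n : ℕ} {X : Set (EuclideanSpace ℝ (Fin n))} (hX : IsCompact X)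
    (hvol : 0 < volume X) : Function.Injective (polyToLp hX) := by
  rw [injective_iff_map_eq_zero]
  intro p hp
  by_contra h0
  have h1 : polyFun p =ᵐ[volume.restrict X] 0 := by
    have := (memLp_polyFun hX p).coeFn_toLp
    have h2 : ((memLp_polyFun hX p).toLp (polyFun p) : Lp ℝ 2 (volume.restrict X)) = 0 := hp
    rw [h2] at this
    exact this.symm.trans (Lp.coeFn_zero _ _ _)
  have h2 : ∀ᵐ x ∂(volume.restrict X), False := by
    filter_upwards [h1, ae_restrict_of_ae (ae_polyFun_ne_zero h0)] with x hx hx'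
    exact hx' hx
  rw [ae_iff] at h2
  simp at h2
  exact hvol.ne' h2

lemma norm_polyToLp_sq {n : ℕ} {X : Set (EuclideanSpace ℝ (Fin n))} (hX : IsCompact X)
    (p : MvPolynomial (Fin n) ℝ) : ‖polyToLp hX p‖ ^ 2 = ∫ x in X, polyFun p x ^ 2 := by
  rw [← real_inner_self_eq_norm_sq, L2.inner_def]
  refine integral_congr_ae ?_
  filter_upwards [(memLp_polyFun hX p).coeFn_toLp] with x hx
  rw [real_inner_self_eq_norm_sq, Real.norm_eq_abs, sq_abs]
  exact congrArg (· ^ 2) hx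

/-- Evaluation at a point is bounded, with respect to the `L²(X)` norm, on polynomials of bounded
degree: these form a finite-dimensional space on which the `L²(X)` seminorm is a norm. The point need
not belong to `X`. -/
lemma exists_sq_polyFun_le {n : ℕ} {X : Set (EuclideanSpace ℝ (Fin n))} (hX : IsCompact X)
    (hvol : 0 < volume X) (D : ℕ) (x₀ : EuclideanSpace ℝ (Fin n)) :
    ∃ c : ℝ, 0 < c ∧ ∀ p : MvPolynomial (Fin n) ℝ, p.totalDegree ≤ D →
      c * polyFun p x₀ ^ 2 ≤ ∫ x in X, polyFun p x ^ 2 := by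
  let V := MvPolynomial.restrictTotalDegree (Fin n) ℝ D
  let T : V →ₗ[ℝ] Lp ℝ 2 (volume.restrict X) := (polyToLp hX).domRestrict V
  have hT : Function.Injective T := (polyToLp_injective hX hvol).comp Subtype.val_injective
  let e := LinearEquiv.ofInjective T hT
  let ev : V →ₗ[ℝ] ℝ := (MvPolynomial.aeval (R := ℝ) x₀.ofLp).toLinearMap ∘ₗ V.subtype
  let φ : LinearMap.range T →ₗ[ℝ] ℝ := ev ∘ₗ e.symm.toLinearMap
  let Φ := LinearMap.toContinuousLinearMap φ
  refine ⟨((‖Φ‖ + 1) ^ 2)⁻¹, by positivity, fun p hp => ?_⟩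
  have hpV : p ∈ V := (MvPolynomial.mem_restrictTotalDegree _ _ _).2 hp
  have h1 : Φ (e ⟨p, hpV⟩) = polyFun p x₀ := by
    simp [Φ, φ, ev, polyFun, MvPolynomial.aeval_eq_eval]
  have h2 : ‖polyFun p x₀‖ ≤ (‖Φ‖ + 1) * ‖polyToLp hX p‖ := by
    rw [← h1]
    refine (Φ.le_opNorm _).trans ?_
    have : ‖e ⟨p, hpV⟩‖ = ‖polyToLp hX p‖ := rfl
    rw [this]
    gcongr
    linarith
  rw [← norm_polyToLp_sq hX, inv_mul_le_iff₀ (by positivity), ← mul_pow, ← sq_abs]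
  exact pow_le_pow_left₀ (abs_nonneg _) h2 2

/-! ### The Christoffel function of the graph of a polynomial -/

/-- The substitution `P(x, y) ↦ P(x, p(x))` of a polynomial for the last variable. -/
noncomputable def substLast {n : ℕ} (p : MvPolynomial (Fin n) ℝ) :
    MvPolynomial (Fin (n + 1)) ℝ →ₐ[ℝ] MvPolynomial (Fin n) ℝ :=
  MvPolynomial.aeval (Fin.snoc (α := fun _ => MvPolynomial (Fin n) ℝ) MvPolynomial.X p)

lemma polyFun_substLast {n : ℕ} (p : MvPolynomial (Fin n) ℝ) (P : MvPolynomial (Fin (n + 1)) ℝ)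
    (x : EuclideanSpace ℝ (Fin n)) : polyFun (substLast p P) x = evalPair P (x, polyFun p x) := by
  have h : ((MvPolynomial.aeval (R := ℝ) x.ofLp).comp (substLast p)) =
      MvPolynomial.aeval (R := ℝ) (Fin.snoc (α := fun _ => ℝ) x.ofLp (polyFun p x)) := by
    ext i
    refine Fin.lastCases ?_ (fun i => ?_) i <;>
      simp [substLast, polyFun, MvPolynomial.aeval_eq_eval]
  have := DFunLike.congr_fun h P
  simpa [MvPolynomial.aeval_eq_eval, polyFun, evalPair] using this

/-- The factor is `max 1 (deg p)`, not `deg p`, because the variables `x` keep their degree one. -/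
lemma totalDegree_substLast_le {n : ℕ} (p : MvPolynomial (Fin n) ℝ)
    (P : MvPolynomial (Fin (n + 1)) ℝ) :
    (substLast p P).totalDegree ≤ P.totalDegree * max 1 p.totalDegree := by
  rw [substLast, MvPolynomial.aeval_def, MvPolynomial.eval₂_eq']
  refine MvPolynomial.totalDegree_finsetSum_le fun m hm => ?_
  refine (MvPolynomial.totalDegree_mul _ _).trans ?_
  rw [MvPolynomial.algebraMap_eq, MvPolynomial.totalDegree_C, zero_add]
  refine (MvPolynomial.totalDegree_finsetProd _ _).trans ?_
  calc _ ≤ ∑ i, m i * max 1 p.totalDegree := by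
        refine Finset.sum_le_sum fun i _ => (MvPolynomial.totalDegree_pow _ _).trans ?_
        gcongr
        refine Fin.lastCases ?_ (fun i => ?_) i <;> simp
    _ = (∑ i, m i) * max 1 p.totalDegree := by rw [Finset.sum_mul]
    _ ≤ _ := by
        gcongr
        have := MvPolynomial.le_totalDegree hm
        rwa [Finsupp.sum_fintype _ _ (by simp)] at this

lemma integral_graphMeasure_polyFun {n : ℕ} {X : Set (EuclideanSpace ℝ (Fin n))}
    (p : MvPolynomial (Fin n) ℝ) (P : MvPolynomial (Fin (n + 1)) ℝ) :
    ∫ w, evalPair P w ^ 2 ∂(graphMeasure X (polyFun p)) =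
      ∫ x in X, polyFun (substLast p P) x ^ 2 := by
  have hc : Continuous (evalPair P) :=
    P.continuous_eval.comp
      (Continuous.finSnoc ((PiLp.continuous_ofLp 2 _).comp continuous_fst) continuous_snd)
  rw [graphMeasure, integral_map]
  · simp_rw [polyFun_substLast]
  · exact (continuous_id.prodMk (continuous_polyFun p)).aemeasurable
  · exact (hc.pow 2).aestronglyMeasurable

lemma christoffel_nonneg {n : ℕ} (μ : Measure (EuclideanSpace ℝ (Fin n) × ℝ)) (d : ℕ)
    (z : EuclideanSpace ℝ (Fin n) × ℝ) : 0 ≤ christoffel μ d z := by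
  refine Real.sInf_nonneg ?_
  rintro r ⟨P, -, -, rfl⟩
  exact integral_nonneg fun w => sq_nonneg _

lemma christoffel_graph_pos {n : ℕ} {X : Set (EuclideanSpace ℝ (Fin n))} (hX : IsCompact X)
    (hvol : 0 < volume X) (p : MvPolynomial (Fin n) ℝ) (d : ℕ) (x : EuclideanSpace ℝ (Fin n)) :
    0 < christoffel (graphMeasure X (polyFun p)) d (x, polyFun p x) := by
  obtain ⟨c, hc, h⟩ := exists_sq_polyFun_le hX hvol (d * max 1 p.totalDegree) x
  refine hc.trans_le (le_csInf ⟨_, 1, by simp, by simp [evalPair], rfl⟩ ?_)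
  rintro r ⟨P, hPd, hP1, rfl⟩
  rw [integral_graphMeasure_polyFun]
  have := h (substLast p P) ((totalDegree_substLast_le p P).trans (by gcongr))
  rwa [polyFun_substLast, hP1, one_pow, mul_one] at this

lemma christoffel_eq_zero_of_ne {n : ℕ} {X : Set (EuclideanSpace ℝ (Fin n))}
    (p : MvPolynomial (Fin n) ℝ) {d : ℕ} (hd : 1 ≤ d) (hpd : p.totalDegree ≤ d)
    (x : EuclideanSpace ℝ (Fin n)) {y : ℝ} (hy : y ≠ polyFun p x) :
    christoffel (graphMeasure X (polyFun p)) d (x, y) = 0 := by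
  refine le_antisymm (csInf_le ⟨0, ?_⟩ ?_) (christoffel_nonneg _ _ _)
  · rintro r ⟨P, -, -, rfl⟩
    exact integral_nonneg fun w => sq_nonneg _
  -- The competitor `(Y - p(X)) / (y - p(x))` vanishes on the graph and is `1` at `(x, y)`.
  let P : MvPolynomial (Fin (n + 1)) ℝ := MvPolynomial.C (y - polyFun p x)⁻¹ *
    (MvPolynomial.X (Fin.last n) - MvPolynomial.rename Fin.castSucc p)
  have hP : ∀ z, evalPair P z = (y - polyFun p x)⁻¹ * (z.2 - polyFun p z.1) := by
    intro z
    have : (Fin.snoc (α := fun _ => ℝ) z.1.ofLp z.2) ∘ Fin.castSucc = z.1.ofLp := by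
      ext i; simp
    simp [P, evalPair, polyFun, MvPolynomial.eval_rename, this]
  refine ⟨P, ?_, ?_, ?_⟩
  · refine (MvPolynomial.totalDegree_mul _ _).trans ?_
    rw [MvPolynomial.totalDegree_C, zero_add]
    refine (MvPolynomial.totalDegree_sub _ _).trans (max_le ?_ ?_)
    · simpa using hd
    · exact (MvPolynomial.totalDegree_rename_le _ _).trans hpd
  · rw [hP]; exact inv_mul_cancel₀ (sub_ne_zero.2 hy)
  · rw [integral_graphMeasure_polyFun]
    simp [polyFun_substLast, hP]

lemma cdArgmax_polyFun {n : ℕ} {X : Set (EuclideanSpace ℝ (Fin n))} (hX : IsCompact X)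
    (hvol : 0 < volume X) (p : MvPolynomial (Fin n) ℝ) {d : ℕ} (hd : 1 ≤ d)
    (hpd : p.totalDegree ≤ d) (x : EuclideanSpace ℝ (Fin n)) :
    cdArgmax X (polyFun p) d x = {polyFun p x} := by
  ext y
  rw [Set.mem_singleton_iff]
  constructor
  · intro h
    by_contra hy
    have := h (polyFun p x)
    rw [christoffel_eq_zero_of_ne p hd hpd x hy] at this
    exact this.not_gt (christoffel_graph_pos hX hvol p d x)
  · rintro rfl y'
    rcases eq_or_ne y' (polyFun p x) with rfl | hy'
    · exact le_rfl
    · rw [christoffel_eq_zero_of_ne p hd hpd x hy']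
      exact christoffel_nonneg _ _ _

lemma cdApprox_polyFun {n : ℕ} {X : Set (EuclideanSpace ℝ (Fin n))} (hX : IsCompact X)
    (hvol : 0 < volume X) (p : MvPolynomial (Fin n) ℝ) {d : ℕ} (hd : 1 ≤ d)
    (hpd : p.totalDegree ≤ d) (x : EuclideanSpace ℝ (Fin n)) :
    cdApprox X (polyFun p) d x = polyFun p x := by
  rw [cdApprox, cdArgmax_polyFun hX hvol p hd hpd, csInf_singleton]

/-! ### The Fejér kernel as an algebraic polynomial -/

lemma abs_sin_nat_mul_le (m : ℕ) (θ : ℝ) : |Real.sin (m * θ)| ≤ m * |Real.sin θ| := by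
  induction m with
  | zero => simp
  | succ m ih =>
    have : ((m + 1 : ℕ) : ℝ) * θ = m * θ + θ := by push_cast; ring
    rw [this, Real.sin_add]
    calc _ ≤ |Real.sin (m * θ)| * |Real.cos θ| + |Real.cos (m * θ)| * |Real.sin θ| := by
          rw [← abs_mul, ← abs_mul]; exact abs_add_le _ _
      _ ≤ |Real.sin (m * θ)| * 1 + 1 * |Real.sin θ| := by
          gcongr
          · exact Real.abs_cos_le_one _
          · exact Real.abs_cos_le_one _
      _ ≤ _ := by push_cast; linarith

/-- The Fejér kernel `(sin mθ / (m sin θ))²` is a polynomial of degree less than `m` in `sin² θ`: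
it equals `(1 - T_m(1 - 2v)) / (2 m² v)` at `v = sin² θ`, with `T_m` the Chebyshev polynomial, and
the numerator is divisible by `v` since `T_m(1) = 1`. -/
lemma exists_fejer_polynomial {m : ℕ} (hm : 1 ≤ m) :
    ∃ Q : Polynomial ℝ, Q.natDegree ≤ m - 1 ∧
      ∀ θ : ℝ, (m : ℝ) ^ 2 * Real.sin θ ^ 2 * Q.eval (Real.sin θ ^ 2) = Real.sin (m * θ) ^ 2 := by
  have hm0 : (m : ℝ) ≠ 0 := by positivity
  let R : Polynomial ℝ := 1 - (Polynomial.Chebyshev.T ℝ m).comp (1 - 2 * Polynomial.X)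
  have hR : R.natDegree ≤ m := by
    refine (Polynomial.natDegree_sub_le _ _).trans (max_le (by simp) ?_)
    refine Polynomial.natDegree_comp_le.trans ?_
    rw [Polynomial.Chebyshev.natDegree_T]
    have : (1 - 2 * Polynomial.X : Polynomial ℝ).natDegree ≤ 1 := by compute_degree
    simpa using Nat.mul_le_mul_left m this
  have hR0 : R.coeff 0 = 0 := by
    rw [Polynomial.coeff_zero_eq_eval_zero]
    simp [R]
  have hdiv : R.divX * Polynomial.X = R := by
    have := R.divX_mul_X_add
    rwa [hR0, Polynomial.C_0, add_zero] at this
  refine ⟨Polynomial.C (2 * (m : ℝ) ^ 2)⁻¹ * R.divX, ?_, fun θ => ?_⟩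
  · refine (Polynomial.natDegree_C_mul_le _ _).trans ?_
    rw [Polynomial.natDegree_divX_eq_natDegree_tsub_one]
    omega
  · have h1 : R.divX.eval (Real.sin θ ^ 2) * Real.sin θ ^ 2 = 2 * Real.sin (m * θ) ^ 2 := by
      have h2 := congrArg (Polynomial.eval (Real.sin θ ^ 2)) hdiv
      have h3 : (1 : ℝ) - 2 * Real.sin θ ^ 2 = Real.cos (2 * θ) := by
        rw [Real.cos_two_mul, Real.cos_sq']; ring
      have h4 : ((m : ℤ) : ℝ) * (2 * θ) = 2 * (m * θ) := by push_cast; ring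
      simp only [R, Polynomial.eval_mul, Polynomial.eval_X, Polynomial.eval_sub,
        Polynomial.eval_one, Polynomial.eval_comp, Polynomial.eval_ofNat, h3,
        Polynomial.Chebyshev.T_real_cos, h4] at h2
      rw [h2, Real.cos_two_mul, Real.cos_sq']
      ring
    simp only [Polynomial.eval_mul, Polynomial.eval_C]
    calc _ = ((m : ℝ) ^ 2 * (2 * (m : ℝ) ^ 2)⁻¹) *
          (R.divX.eval (Real.sin θ ^ 2) * Real.sin θ ^ 2) := by ring
      _ = _ := by rw [h1]; field_simp

/-- In terms of `u = |sin θ|`, the Fejér kernel is bounded below for `u < 1 / m` and decays like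
`(1 + m u)⁻²` on `[0, 1]`. -/
lemma exists_concentrated_polynomial {m : ℕ} (hm : 1 ≤ m) :
    ∃ Q : Polynomial ℝ, Q.natDegree ≤ m - 1 ∧ ∀ u ∈ Set.Icc (0 : ℝ) 1,
      0 ≤ Q.eval (u ^ 2) ∧ Q.eval (u ^ 2) ≤ 4 * ((1 + m * u) ^ 2)⁻¹ ∧
      (m * u < 1 → (2 / Real.pi) ^ 2 ≤ Q.eval (u ^ 2)) := by
  obtain ⟨Q, hdeg, hQ⟩ := exists_fejer_polynomial hm
  have hm0 : (0 : ℝ) < m := by positivity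
  refine ⟨Q, hdeg, ?_⟩
  have hc : Continuous fun u : ℝ => Q.eval (u ^ 2) := Q.continuous.comp (continuous_pow 2)
  have hcl : closure (Set.Ioc (0 : ℝ) 1) = Set.Icc 0 1 := closure_Ioc zero_ne_one
  -- The three bounds hold for `u = sin θ` with `θ ∈ (0, π / 2]`.
  have main : ∀ u ∈ Set.Ioc (0 : ℝ) 1, 0 ≤ Q.eval (u ^ 2) ∧ Q.eval (u ^ 2) ≤ 1 ∧
      (m * u) ^ 2 * Q.eval (u ^ 2) ≤ 1 ∧ (m * u ≤ 1 → (2 / Real.pi) ^ 2 ≤ Q.eval (u ^ 2)) := by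
    rintro u ⟨hu0, hu1⟩
    obtain ⟨θ, hθ0, hθ1, rfl⟩ : ∃ θ, 0 ≤ θ ∧ θ ≤ Real.pi / 2 ∧ Real.sin θ = u :=
      ⟨Real.arcsin u, Real.arcsin_nonneg.2 hu0.le, Real.arcsin_le_pi_div_two u,
        Real.sin_arcsin (by linarith) hu1⟩
    have h := hQ θ
    rw [← mul_pow] at h
    have hpos : 0 < ((m : ℝ) * Real.sin θ) ^ 2 := by positivity
    have hQe : Q.eval (Real.sin θ ^ 2) = Real.sin (m * θ) ^ 2 / ((m : ℝ) * Real.sin θ) ^ 2 := by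
      rw [← h]; field_simp
    refine ⟨by rw [hQe]; positivity, ?_, ?_, ?_⟩
    · rw [hQe, div_le_one hpos]
      have := abs_sin_nat_mul_le m θ
      rw [abs_of_pos hu0] at this
      rw [← sq_abs (Real.sin (m * θ))]
      gcongr
    · rw [h]; exact Real.sin_sq_le_one _
    · intro hmu
      have hθs := Real.mul_le_sin hθ0 hθ1
      have hmθ : m * θ ≤ Real.pi / 2 := by
        have h5 : m * (2 / Real.pi * θ) ≤ 1 := (by gcongr : _ ≤ m * Real.sin θ).trans hmu
        rw [le_div_iff₀ two_pos]
        have hpi := Real.pi_pos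
        field_simp at h5
        linarith
      have h6 := Real.mul_le_sin (by positivity : 0 ≤ m * θ) hmθ
      rw [hQe, ← div_pow]
      refine pow_le_pow_left₀ (by positivity) ?_ 2
      rw [le_div_iff₀ (by positivity)]
      refine le_trans ?_ h6
      gcongr
      exact Real.sin_le hθ0
  -- The value at `u = 0`, where the quotient of sines is meaningless, is reached by continuity.
  have ext : ∀ g : ℝ → ℝ, Continuous g → (∀ u ∈ Set.Ioc (0 : ℝ) 1, 0 ≤ g u) →
      ∀ u ∈ Set.Icc (0 : ℝ) 1, 0 ≤ g u := by
    intro g hg h u hu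
    rw [← hcl] at hu
    exact closure_minimal h (isClosed_le continuous_const hg) hu
  intro u hu
  have h0 := ext _ hc (fun u hu => (main u hu).1) u hu
  have h1 := ext (fun u => 1 - Q.eval (u ^ 2)) (by fun_prop)
    (fun u hu => sub_nonneg.2 (main u hu).2.1) u hu
  have h2 := ext (fun u => 1 - (m * u) ^ 2 * Q.eval (u ^ 2)) (by fun_prop)
    (fun u hu => sub_nonneg.2 (main u hu).2.2.1) u hu
  refine ⟨h0, ?_, fun hmu => ?_⟩
  · have hmu0 : 0 ≤ m * u := mul_nonneg hm0.le hu.1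
    rw [← div_eq_mul_inv, le_div_iff₀ (by positivity)]
    have h3 : (1 + m * u) ^ 2 ≤ 2 * (1 + (m * u) ^ 2) := by nlinarith [sq_nonneg (1 - m * u)]
    have h4 := mul_le_mul_of_nonneg_left h3 h0
    linarith
  · rcases hu.1.eq_or_lt with rfl | hu0
    · -- The hypothesis `m u < 1` holds near `u = 0`, so the lower bound also passes to the limit.
      have hε : (0 : ℝ) ∈ closure (Set.Ioo 0 (1 / m : ℝ)) := by
        rw [closure_Ioo (by positivity)]; exact ⟨le_rfl, by positivity⟩
      have : Set.Ioo 0 (1 / m : ℝ) ⊆ {u : ℝ | (2 / Real.pi) ^ 2 ≤ Q.eval (u ^ 2)} := by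
        rintro v ⟨hv0, hv1⟩
        have hm1 : (1 : ℝ) / m ≤ 1 := by
          rw [div_le_one hm0]; exact_mod_cast hm
        refine (main v ⟨hv0, hv1.le.trans hm1⟩).2.2.2 ?_
        rw [lt_div_iff₀ hm0] at hv1
        linarith
      exact closure_minimal this (isClosed_le continuous_const hc) hε
    · exact (main u ⟨hu0, hu.2⟩).2.2.2 hmu.le

/-! ### Extension to a compactly supported function -/

lemma IsCkOn.exists_contDiff_hasCompactSupport {n k : ℕ} {f : EuclideanSpace ℝ (Fin n) → ℝ}
    {X : Set (EuclideanSpace ℝ (Fin n))} (hX : IsCompact X) (hf : IsCkOn k f X) :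
    ∃ F : EuclideanSpace ℝ (Fin n) → ℝ, ContDiff ℝ k F ∧ HasCompactSupport F ∧ Set.EqOn f F X := by
  obtain ⟨U, G, hU, hXU, hG, hfG⟩ := hf
  obtain ⟨K, hK, hXK, hKU⟩ := exists_compact_between hX hU hXU
  obtain ⟨χ, hχ0, hχ1, -⟩ := exists_contMDiffMap_zero_one_of_isClosed (n := k)
    (modelWithCornersSelf ℝ (EuclideanSpace ℝ (Fin n))) (s := (interior K)ᶜ) (t := X)
    isOpen_interior.isClosed_compl hX.isClosed
    (Set.disjoint_left.2 fun x hx hx' => hx (hXK hx'))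
  have hχ : ContDiff ℝ k χ := χ.contMDiff.contDiff
  have hzero : ∀ x ∉ K, χ x * G x = 0 := fun x hx => by
    have : χ x = 0 := hχ0 (fun h => hx (interior_subset h))
    rw [this, zero_mul]
  refine ⟨fun x => χ x * G x, contDiff_iff_contDiffAt.2 fun x => ?_,
    HasCompactSupport.intro hK hzero, fun x hx => ?_⟩
  · by_cases hx : x ∈ U
    · exact hχ.contDiffAt.mul (hG.contDiffAt (hU.mem_nhds hx))
    · have h0 : (fun x => χ x * G x) =ᶠ[nhds x] fun _ => 0 := by
        filter_upwards [hK.isClosed.isOpen_compl.mem_nhds fun h => hx (hKU h)] with y hy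
        exact hzero y hy
      exact contDiffAt_const.congr_of_eventuallyEq h0
  · have : χ x = 1 := hχ1 hx
    simp only [this, one_mul, hfG hx]

/-! ### Finite differences -/

/-- Induction on `k`: the mean value theorem bounds the `k`-th derivative of `Δ_h F` by `‖h‖` times
the bound for the `(k + 1)`-st derivative of `F`. -/
lemma norm_fwdDiff_iter_le {E G : Type*} [NormedAddCommGroup E] [NormedSpace ℝ E]
    [NormedAddCommGroup G] [NormedSpace ℝ G] {k : ℕ} {M : ℝ} {F : E → G}
    (hF : ContDiff ℝ k F) (hM : ∀ x, ‖iteratedFDeriv ℝ k F x‖ ≤ M) (h x : E) :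
    ‖(fwdDiff h)^[k] F x‖ ≤ M * ‖h‖ ^ k := by
  induction k generalizing F M with
  | zero => simpa using hM x
  | succ k ih =>
    have hFk : ContDiff ℝ k F := hF.of_le (by exact_mod_cast k.le_succ)
    have hFh : ContDiff ℝ k fun y => F (y + h) := hFk.comp (contDiff_id.add contDiff_const)
    rw [Function.iterate_succ_apply]
    have key := ih (F := fwdDiff h F) (M := M * ‖h‖) (hFh.sub hFk) fun y => by
      have e : iteratedFDeriv ℝ k (fwdDiff h F) y =
          iteratedFDeriv ℝ k F (y + h) - iteratedFDeriv ℝ k F y := by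
        rw [← iteratedFDeriv_comp_add_right, ← iteratedFDeriv_sub_apply hFh.contDiffAt
          hFk.contDiffAt]
        rfl
      rw [e]
      have hd : Differentiable ℝ (iteratedFDeriv ℝ k F) :=
        hF.differentiable_iteratedFDeriv (by exact_mod_cast k.lt_succ_self)
      have := convex_univ.norm_image_sub_le_of_norm_fderiv_le (𝕜 := ℝ)
        (fun z _ => hd z) (fun z _ => norm_fderiv_iteratedFDeriv.trans_le (hM z))
        (Set.mem_univ y) (Set.mem_univ (y + h))
      simpa using this
    refine key.trans_eq ?_
    rw [pow_succ]; ring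

/-! ### Convolution with a polynomial kernel -/

/-- Integrating a polynomial in `x` whose coefficients are continuous functions of `y`, against a
compactly supported `F(y)`, gives a polynomial in `x` of no larger degree. The kernel is encoded as
a polynomial `G` over the ring of continuous functions, evaluated at `y` coefficientwise. -/
lemma exists_polyFun_eq_integral {n : ℕ} {F : EuclideanSpace ℝ (Fin n) → ℝ} (hF : Continuous F)
    (hFs : HasCompactSupport F) (G : MvPolynomial (Fin n) C(EuclideanSpace ℝ (Fin n), ℝ)) :
    ∃ p : MvPolynomial (Fin n) ℝ, p.totalDegree ≤ G.totalDegree ∧ ∀ x, polyFun p x =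
      ∫ y, F y * MvPolynomial.eval₂Hom (Pi.evalRingHom _ y |>.comp
        (ContinuousMap.coeFnRingHom (α := EuclideanSpace ℝ (Fin n)) (β := ℝ))) x.ofLp G := by
  refine ⟨∑ d ∈ G.support, MvPolynomial.monomial d (∫ y, F y * G.coeff d y), ?_, fun x => ?_⟩
  · refine MvPolynomial.totalDegree_finsetSum_le fun d hd => ?_
    exact (MvPolynomial.totalDegree_monomial_le _ _).trans (MvPolynomial.le_totalDegree hd)
  · have hint : ∀ d, Integrable fun y => F y * G.coeff d y := fun d =>
      (hF.mul (G.coeff d).continuous).integrable_of_hasCompactSupport hFs.mul_right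
    simp only [MvPolynomial.coe_eval₂Hom, MvPolynomial.eval₂_eq', polyFun, map_sum,
      MvPolynomial.eval_monomial, Finset.mul_sum, ← mul_assoc]
    rw [integral_finsetSum]
    · refine Finset.sum_congr rfl fun d _ => ?_
      rw [Finsupp.prod_fintype _ _ (by simp), ← integral_mul_const]
      rfl
    · exact fun d _ => (hint d).mul_const _

/-- The kernel `V(‖y - x‖²)` is a polynomial in `x` of degree at most `2 deg V`, because
`‖y - x‖² = ∑ᵢ (yᵢ - xᵢ)²` for the Euclidean norm. -/
lemma exists_polyFun_eq_convolution {n : ℕ} {F : EuclideanSpace ℝ (Fin n) → ℝ} (hF : Continuous F)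
    (hFs : HasCompactSupport F) (V : Polynomial ℝ) :
    ∃ p : MvPolynomial (Fin n) ℝ, p.totalDegree ≤ 2 * V.natDegree ∧ ∀ x, polyFun p x =
      ∫ y, F y * V.eval (‖y - x‖ ^ 2) := by
  let S : MvPolynomial (Fin n) C(EuclideanSpace ℝ (Fin n), ℝ) := ∑ i,
    (MvPolynomial.C ⟨fun y : EuclideanSpace ℝ (Fin n) => y i, by fun_prop⟩ - MvPolynomial.X i) ^ 2
  let φ : ℝ →+* MvPolynomial (Fin n) C(EuclideanSpace ℝ (Fin n), ℝ) :=
    MvPolynomial.C.comp ContinuousMap.C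
  have hS : S.totalDegree ≤ 2 := by
    refine MvPolynomial.totalDegree_finsetSum_le fun i _ => ?_
    refine (MvPolynomial.totalDegree_pow _ _).trans ?_
    have := (MvPolynomial.totalDegree_sub
      (MvPolynomial.C (⟨fun y : EuclideanSpace ℝ (Fin n) => y i, by fun_prop⟩ :
        C(EuclideanSpace ℝ (Fin n), ℝ))) (MvPolynomial.X i))
    rw [MvPolynomial.totalDegree_C, MvPolynomial.totalDegree_X] at this
    omega
  obtain ⟨p, hp, hpx⟩ := exists_polyFun_eq_integral hF hFs (V.eval₂ φ S)
  refine ⟨p, hp.trans ?_, fun x => ?_⟩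
  · rw [Polynomial.eval₂_eq_sum_range]
    refine MvPolynomial.totalDegree_finsetSum_le fun i hi => ?_
    refine (MvPolynomial.totalDegree_mul _ _).trans ?_
    have h1 : (φ (V.coeff i)).totalDegree = 0 := MvPolynomial.totalDegree_C _
    have h2 := MvPolynomial.totalDegree_pow S i
    have h3 : i ≤ V.natDegree := by rw [Finset.mem_range] at hi; omega
    nlinarith
  · rw [hpx]
    refine integral_congr_ae (ae_of_all _ fun y => ?_)
    simp only
    rw [Polynomial.hom_eval₂, Subsingleton.elim (RingHom.comp _ φ) (RingHom.id ℝ),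
      Polynomial.eval₂_id]
    congr 2
    simp [S, EuclideanSpace.norm_sq_eq]

/-! ### A radial kernel with small moments -/

/-- A polynomial in `‖t‖²`, of degree at most `s` in `t`, that is nonnegative and of mass one on the
ball of radius `A` and whose `k`-th moment is `O(s^{-k})`. It is the normalised `r`-th power of the
Fejér kernel at `u = ‖t‖ / A`, with `r = k + n + 1` large enough for the `k`-th moment of
`(1 + ‖z‖)^{-2r}` to be finite on `ℝⁿ`; the concentration is at the scale `A / m` with
`m ~ s / (2r)`. -/
lemma exists_radial_kernel (n k : ℕ) {A : ℝ} (hA : 0 < A) :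
    ∃ c : ℝ, 0 < c ∧ ∀ s : ℕ, 1 ≤ s → ∃ W : Polynomial ℝ, 2 * W.natDegree ≤ s ∧
      (∀ t ∈ Metric.closedBall (0 : EuclideanSpace ℝ (Fin n)) A, 0 ≤ W.eval (‖t‖ ^ 2)) ∧
      ∫ t in Metric.closedBall (0 : EuclideanSpace ℝ (Fin n)) A, W.eval (‖t‖ ^ 2) = 1 ∧
      ∫ t in Metric.closedBall (0 : EuclideanSpace ℝ (Fin n)) A,
        ‖t‖ ^ k * W.eval (‖t‖ ^ 2) ≤ c / (s : ℝ) ^ k := by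
  set B := Metric.closedBall (0 : EuclideanSpace ℝ (Fin n)) A with hB
  have hBc : IsCompact B := isCompact_closedBall _ _
  set r := k + n + 1 with hr
  let g : EuclideanSpace ℝ (Fin n) → ℝ := fun z => ((1 + ‖z‖) ^ (n + 1))⁻¹
  have hg : Integrable g := by
    have := integrable_one_add_norm (μ := (volume : Measure (EuclideanSpace ℝ (Fin n))))
      (r := ((n + 1 : ℕ) : ℝ)) (by simp)
    refine this.congr (ae_of_all _ fun z => ?_)
    simp only [g]
    rw [Real.rpow_neg (by positivity), Real.rpow_natCast]
  have hg0 : ∀ z, 0 ≤ g z := fun z => by positivity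
  set v := volume.real (Metric.ball (0 : EuclideanSpace ℝ (Fin n)) 1) with hv
  have hv0 : 0 < v := ENNReal.toReal_pos (Metric.measure_ball_pos _ _ one_pos).ne'
    measure_ball_lt_top.ne
  set b := ((2 / Real.pi) ^ 2) ^ r with hb
  have hb0 : 0 < b := by positivity
  have hG0 : 0 ≤ ∫ z, g z := integral_nonneg hg0
  refine ⟨(2 * r * A) ^ k * (4 ^ r * (∫ z, g z) / (b * v)) + 1, by positivity, fun s hs => ?_⟩
  -- `m - 1` is the largest degree for which the `r`-th power, taken in `‖t‖²`, has degree at most `s`.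
  set m := s / (2 * r) + 1 with hm
  have hm1 : 1 ≤ m := Nat.succ_pos _
  obtain ⟨Q, hQd, hQ⟩ := exists_concentrated_polynomial hm1
  set a : ℝ := m / A with ha
  have ha0 : 0 < a := by positivity
  let W₀ : Polynomial ℝ := (Q.comp (Polynomial.C (A ^ 2)⁻¹ * Polynomial.X)) ^ r
  have hW₀ : ∀ t : EuclideanSpace ℝ (Fin n), W₀.eval (‖t‖ ^ 2) = Q.eval ((‖t‖ / A) ^ 2) ^ r := by
    intro t
    simp only [W₀, Polynomial.eval_pow, Polynomial.eval_comp, Polynomial.eval_mul,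
      Polynomial.eval_C, Polynomial.eval_X]
    congr 2
    field_simp
  have hmem : ∀ t ∈ B, ‖t‖ / A ∈ Set.Icc (0 : ℝ) 1 := fun t ht =>
    ⟨by positivity, (div_le_one hA).2 (by simpa [hB] using ht)⟩
  have hmu : ∀ t : EuclideanSpace ℝ (Fin n), m * (‖t‖ / A) = ‖a • t‖ := fun t => by
    rw [norm_smul, Real.norm_of_nonneg ha0.le, ha]; ring
  have hW₀deg : 2 * W₀.natDegree ≤ s := by
    have h1 : (Polynomial.C (A ^ 2)⁻¹ * Polynomial.X : Polynomial ℝ).natDegree ≤ 1 :=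
      (Polynomial.natDegree_C_mul_le _ _).trans Polynomial.natDegree_X_le
    have h2 : W₀.natDegree ≤ r * ((m - 1) * 1) := by
      refine Polynomial.natDegree_pow_le.trans ?_
      gcongr
      exact Polynomial.natDegree_comp_le.trans (Nat.mul_le_mul hQd h1)
    have h3 : 2 * r * (s / (2 * r)) ≤ s := Nat.mul_div_le _ _
    have h4 : m - 1 = s / (2 * r) := Nat.add_sub_cancel _ _
    rw [h4] at h2
    nlinarith
  have hcont : Continuous fun t : EuclideanSpace ℝ (Fin n) => W₀.eval (‖t‖ ^ 2) :=
    W₀.continuous.comp (by fun_prop)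
  have hnonneg : ∀ t ∈ B, 0 ≤ W₀.eval (‖t‖ ^ 2) := fun t ht => by
    rw [hW₀]; exact pow_nonneg (hQ _ (hmem t ht)).1 _
  -- With `ρ = ‖a • t‖`, the factor `ρ ^ k` is absorbed by the decay of the kernel.
  have hpow : ∀ t ∈ B, ‖t‖ ^ k * W₀.eval (‖t‖ ^ 2) ≤ (a ^ k)⁻¹ * 4 ^ r * g (a • t) := by
    intro t ht
    obtain ⟨h0, h1, -⟩ := hQ _ (hmem t ht)
    rw [hmu] at h1
    set ρ := ‖a • t‖ with hρ
    have hρ0 : 0 ≤ ρ := norm_nonneg _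
    have ht' : ‖t‖ ^ k = (a ^ k)⁻¹ * ρ ^ k := by
      rw [hρ, norm_smul, Real.norm_of_nonneg ha0.le, mul_pow]; field_simp
    have h2 : W₀.eval (‖t‖ ^ 2) ≤ 4 ^ r * (((1 + ρ) ^ 2)⁻¹) ^ r := by
      rw [hW₀, ← mul_pow]; exact pow_le_pow_left₀ h0 h1 _
    have h3 : ρ ^ k * (((1 + ρ) ^ 2)⁻¹) ^ r ≤ ((1 + ρ) ^ (n + 1))⁻¹ := by
      rw [inv_pow, ← div_eq_mul_inv, ← one_div, div_le_div_iff₀ (by positivity) (by positivity),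
        one_mul]
      calc ρ ^ k * (1 + ρ) ^ (n + 1) ≤ (1 + ρ) ^ k * (1 + ρ) ^ (n + 1) := by
            gcongr; linarith
        _ = (1 + ρ) ^ r := by rw [← pow_add, hr, add_assoc]
        _ ≤ ((1 + ρ) ^ 2) ^ r := by
            gcongr; nlinarith
    calc ‖t‖ ^ k * W₀.eval (‖t‖ ^ 2) ≤ ‖t‖ ^ k * (4 ^ r * (((1 + ρ) ^ 2)⁻¹) ^ r) := by gcongr
      _ = (a ^ k)⁻¹ * 4 ^ r * (ρ ^ k * (((1 + ρ) ^ 2)⁻¹) ^ r) := by rw [ht']; ring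
      _ ≤ _ := by gcongr
  set J := ∫ t in B, W₀.eval (‖t‖ ^ 2) with hJ
  have hupper : ∫ t in B, ‖t‖ ^ k * W₀.eval (‖t‖ ^ 2) ≤
      (a ^ k)⁻¹ * 4 ^ r * ((a ^ n)⁻¹ * ∫ z, g z) := by
    have hga : Integrable fun t => (a ^ k)⁻¹ * 4 ^ r * g (a • t) :=
      (hg.comp_smul ha0.ne').const_mul _
    calc _ ≤ ∫ t in B, (a ^ k)⁻¹ * 4 ^ r * g (a • t) :=
          setIntegral_mono_on
            (((continuous_norm.pow k).mul hcont).continuousOn.integrableOn_compact hBc)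
            hga.integrableOn hBc.measurableSet hpow
      _ ≤ ∫ t, (a ^ k)⁻¹ * 4 ^ r * g (a • t) :=
          setIntegral_le_integral hga (ae_of_all _ fun t => mul_nonneg (by positivity) (hg0 _))
      _ = _ := by
          rw [integral_const_mul, Measure.integral_comp_smul_of_nonneg _ _ _ (hR := ha0.le)]
          simp
  have hlower : b * ((a ^ n)⁻¹ * v) ≤ J := by
    -- On the ball of radius `1 / a = A / m` the kernel is bounded below.
    have hsub : Metric.ball (0 : EuclideanSpace ℝ (Fin n)) a⁻¹ ⊆ B := by
      refine Metric.ball_subset_closedBall.trans (Metric.closedBall_subset_closedBall ?_)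
      rw [ha, inv_div]
      exact div_le_self hA.le (by exact_mod_cast hm1)
    have hvol : volume.real (Metric.ball (0 : EuclideanSpace ℝ (Fin n)) a⁻¹) = (a ^ n)⁻¹ * v := by
      rw [Measure.real, Measure.addHaar_ball_of_pos _ _ (inv_pos.2 ha0), ENNReal.toReal_mul,
        ENNReal.toReal_ofReal (by positivity)]
      simp [hv, Measure.real]
    rw [← hvol, mul_comm b, ← smul_eq_mul, ← setIntegral_const]
    refine le_trans (setIntegral_mono_on (by simp [measure_ball_lt_top])
      ((hcont.continuousOn.integrableOn_compact hBc).mono_set hsub)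
      Metric.isOpen_ball.measurableSet fun t ht => ?_)
      (setIntegral_mono_set (hcont.continuousOn.integrableOn_compact hBc)
        ((ae_restrict_iff' hBc.measurableSet).2 (ae_of_all _ hnonneg)) hsub.eventuallyLE)
    rw [hW₀]
    refine pow_le_pow_left₀ (by positivity) ((hQ _ (hmem t (hsub ht))).2.2 ?_) _
    rw [hmu, norm_smul, Real.norm_of_nonneg ha0.le, ← lt_inv_mul_iff₀ ha0, mul_one]
    simpa using ht
  have hJ0 : 0 < J := lt_of_lt_of_le (by positivity) hlower
  refine ⟨Polynomial.C J⁻¹ * W₀, ?_, fun t ht => ?_, ?_, ?_⟩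
  · exact (Nat.mul_le_mul_left 2 (Polynomial.natDegree_C_mul_le _ _)).trans hW₀deg
  · rw [Polynomial.eval_mul, Polynomial.eval_C]
    exact mul_nonneg (inv_nonneg.2 hJ0.le) (hnonneg t ht)
  · simp only [Polynomial.eval_mul, Polynomial.eval_C]
    rw [integral_const_mul, inv_mul_cancel₀ hJ0.ne']
  · have hs0 : (0 : ℝ) < s := by exact_mod_cast hs
    have e : ∀ t : EuclideanSpace ℝ (Fin n), ‖t‖ ^ k * (Polynomial.C J⁻¹ * W₀).eval (‖t‖ ^ 2) =
        J⁻¹ * (‖t‖ ^ k * W₀.eval (‖t‖ ^ 2)) := fun t => by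
      rw [Polynomial.eval_mul, Polynomial.eval_C]; ring
    simp only [e]
    rw [integral_const_mul]
    have hsm : (a ^ k)⁻¹ ≤ (2 * r * A) ^ k / (s : ℝ) ^ k := by
      rw [← inv_pow, ← div_pow]
      refine pow_le_pow_left₀ (by positivity) ?_ k
      rw [ha, inv_div, div_le_div_iff₀ (by positivity) hs0]
      have : s < 2 * r * m := by
        rw [hm]; exact Nat.lt_mul_div_succ s (by omega)
      have : (s : ℝ) ≤ 2 * r * m := by exact_mod_cast this.le
      nlinarith
    calc _ ≤ (b * ((a ^ n)⁻¹ * v))⁻¹ * ((a ^ k)⁻¹ * 4 ^ r * ((a ^ n)⁻¹ * ∫ z, g z)) := by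
          refine mul_le_mul (inv_anti₀ (by positivity) hlower) hupper ?_ (by positivity)
          exact setIntegral_nonneg hBc.measurableSet fun t ht =>
            mul_nonneg (by positivity) (hnonneg t ht)
      _ = (a ^ k)⁻¹ * (4 ^ r * (∫ z, g z) / (b * v)) := by field_simp
      _ ≤ (2 * r * A) ^ k / (s : ℝ) ^ k * (4 ^ r * (∫ z, g z) / (b * v)) := by gcongr
      _ = (2 * r * A) ^ k * (4 ^ r * (∫ z, g z) / (b * v)) / (s : ℝ) ^ k := by ring
      _ ≤ _ := by gcongr; linarith

/-! ### The multivariate Jackson theorem -/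

/-- If `F` vanishes outside the ball of radius `R`, then for `‖x‖ ≤ R` and `j ≥ 1` the integrand
vanishes for `‖t‖ > 2R`; the integral thus extends over the whole space, where the substitution
`y = x + j t` makes it a convolution of `F` with a polynomial kernel. -/
lemma exists_polyFun_eq_dilated_average {n : ℕ} {F : EuclideanSpace ℝ (Fin n) → ℝ}
    (hF : Continuous F) (hFs : HasCompactSupport F) {R : ℝ} (hFR : ∀ x, R ≤ ‖x‖ → F x = 0)
    (W : Polynomial ℝ) {j : ℕ} (hj : 1 ≤ j) :
    ∃ p : MvPolynomial (Fin n) ℝ, p.totalDegree ≤ 2 * W.natDegree ∧ ∀ x, ‖x‖ ≤ R →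
      polyFun p x = ∫ t in Metric.closedBall (0 : EuclideanSpace ℝ (Fin n)) (2 * R),
        F (x + j • t) * W.eval (‖t‖ ^ 2) := by
  have hj0 : (0 : ℝ) < j := by exact_mod_cast hj
  obtain ⟨p, hp, hpx⟩ := exists_polyFun_eq_convolution hF hFs
    (W.comp (Polynomial.C ((j : ℝ) ^ 2)⁻¹ * Polynomial.X))
  refine ⟨MvPolynomial.C ((j : ℝ) ^ n)⁻¹ * p, ?_, fun x hx => ?_⟩
  · refine (MvPolynomial.totalDegree_mul _ _).trans ?_
    rw [MvPolynomial.totalDegree_C, zero_add]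
    refine hp.trans (Nat.mul_le_mul_left 2 (Polynomial.natDegree_comp_le.trans ?_))
    exact (Nat.mul_le_mul_left _ ((Polynomial.natDegree_C_mul_le _ _).trans
      Polynomial.natDegree_X_le)).trans (mul_one _).le
  · rw [setIntegral_eq_integral_of_forall_compl_eq_zero]
    · have h1 := Measure.integral_comp_smul_of_nonneg volume
        (fun z : EuclideanSpace ℝ (Fin n) => F (x + z) * W.eval (((j : ℝ) ^ 2)⁻¹ * ‖z‖ ^ 2))
        (j : ℝ) (hR := hj0.le)
      have h2 : ∀ t : EuclideanSpace ℝ (Fin n), ((j : ℝ) ^ 2)⁻¹ * ‖(j : ℝ) • t‖ ^ 2 = ‖t‖ ^ 2 := by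
        intro t
        rw [norm_smul, Real.norm_of_nonneg hj0.le, mul_pow]; field_simp
      simp only [h2] at h1
      simp only [Nat.cast_smul_eq_nsmul] at h1
      rw [h1, ← integral_sub_right_eq_self _ x]
      have h3 : polyFun (MvPolynomial.C ((j : ℝ) ^ n)⁻¹ * p) x =
          ((j : ℝ) ^ n)⁻¹ * polyFun p x := by simp [polyFun]
      rw [h3, hpx]
      simp
    · intro t ht
      have ht' : 2 * R < ‖t‖ := by simpa using ht
      rw [hFR, zero_mul]
      have h4 : ‖t‖ ≤ ‖j • t‖ := by
        rw [← Nat.cast_smul_eq_nsmul ℝ, norm_smul, Real.norm_of_nonneg hj0.le]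
        exact le_mul_of_one_le_left (norm_nonneg _) (by exact_mod_cast hj)
      have h5 := norm_sub_norm_le (j • t) (-x)
      rw [norm_neg, sub_neg_eq_add, add_comm] at h5
      linarith

/-- A multivariate Jackson theorem: a `C^k` function near a compact set is approximated on it by
polynomials of total degree at most `s` with error `O(s^{-k})`. -/
theorem IsCkOn.exists_polyFun_approx {n k : ℕ} {f : EuclideanSpace ℝ (Fin n) → ℝ}
    {X : Set (EuclideanSpace ℝ (Fin n))} (hX : IsCompact X) (hf : IsCkOn k f X) :
    ∃ C : ℝ, 0 < C ∧ ∀ s : ℕ, 1 ≤ s → ∃ p : MvPolynomial (Fin n) ℝ, p.totalDegree ≤ s ∧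
      ∀ x ∈ X, |f x - polyFun p x| ≤ C / (s : ℝ) ^ k := by
  obtain ⟨F, hF, hFs, hfF⟩ := hf.exists_contDiff_hasCompactSupport hX
  obtain ⟨M, hM⟩ := (hF.continuous_iteratedFDeriv le_rfl).bounded_above_of_compact_support
    (hFs.iteratedFDeriv (𝕜 := ℝ) k)
  have hM0 : 0 ≤ M := (norm_nonneg _).trans (hM 0)
  obtain ⟨R, hR0, hR⟩ := (hX.union hFs).isBounded.subset_ball_lt 0 0
  have hFR : ∀ x, R ≤ ‖x‖ → F x = 0 := fun x hx => by
    by_contra h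
    have := hR (Or.inr (subset_tsupport F h))
    rw [mem_ball_zero_iff] at this
    linarith
  have hXR : ∀ x ∈ X, ‖x‖ ≤ R := fun x hx => by
    have := hR (Or.inl hx)
    rw [mem_ball_zero_iff] at this
    exact this.le
  obtain ⟨c, hc, hker⟩ := exists_radial_kernel n k (A := 2 * R) (by positivity)
  refine ⟨(M + 1) * c, by positivity, fun s hs => ?_⟩
  obtain ⟨W, hWd, hW0, hW1, hWk⟩ := hker s hs
  set B := Metric.closedBall (0 : EuclideanSpace ℝ (Fin n)) (2 * R) with hB
  have hBc : IsCompact B := isCompact_closedBall _ _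
  have hWc : Continuous fun t : EuclideanSpace ℝ (Fin n) => W.eval (‖t‖ ^ 2) :=
    W.continuous.comp (by fun_prop)
  have hpoly : ∀ j : ℕ, ∃ p : MvPolynomial (Fin n) ℝ, p.totalDegree ≤ 2 * W.natDegree ∧
      ∀ x, ‖x‖ ≤ R → polyFun p x = ∫ t in B, F (x + (j + 1) • t) * W.eval (‖t‖ ^ 2) := fun j =>
    exists_polyFun_eq_dilated_average hF.continuous hFs hFR W j.succ_pos
  choose p hpd hp using hpoly
  -- The coefficients of the `k`-th forward difference; the term `j = 0` is `(-1) ^ k * F x`.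
  let coef : ℕ → ℝ := fun j => (-1) ^ (k - j) * k.choose j
  refine ⟨-(MvPolynomial.C ((-1) ^ k) *
    ∑ j ∈ Finset.range k, MvPolynomial.C (coef (j + 1)) * p j), ?_, fun x hx => ?_⟩
  · rw [MvPolynomial.totalDegree_neg]
    refine (MvPolynomial.totalDegree_mul _ _).trans ?_
    rw [MvPolynomial.totalDegree_C, zero_add]
    refine MvPolynomial.totalDegree_finsetSum_le fun j _ => ?_
    refine (MvPolynomial.totalDegree_mul _ _).trans ?_
    rw [MvPolynomial.totalDegree_C, zero_add]
    exact (hpd j).trans hWd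
  · have hint : ∀ j : ℕ, IntegrableOn (fun t => coef j * (F (x + j • t) * W.eval (‖t‖ ^ 2))) B :=
      fun j => (continuous_const.mul ((hF.continuous.comp (by fun_prop)).mul
        hWc)).continuousOn.integrableOn_compact hBc
    have hdiff : ∀ t, (fwdDiff t)^[k] F x * W.eval (‖t‖ ^ 2) =
        ∑ j ∈ Finset.range (k + 1), coef j * (F (x + j • t) * W.eval (‖t‖ ^ 2)) := fun t => by
      rw [fwdDiff_iter_eq_sum_shift, Finset.sum_mul]
      refine Finset.sum_congr rfl fun j _ => ?_
      simp only [zsmul_eq_mul, coef]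
      push_cast
      ring
    have hsum : ∫ t in B, (fwdDiff t)^[k] F x * W.eval (‖t‖ ^ 2) =
        (-1) ^ k * F x + ∑ j ∈ Finset.range k, coef (j + 1) * polyFun (p j) x := by
      simp only [hdiff]
      rw [integral_finsetSum _ fun j _ => hint j, Finset.sum_range_succ', add_comm]
      congr 1
      · simp [coef, integral_const_mul, hW1]
      · refine Finset.sum_congr rfl fun j _ => ?_
        rw [integral_const_mul, hp j x (hXR x hx)]
    have heval : f x - polyFun (-(MvPolynomial.C ((-1) ^ k) *
        ∑ j ∈ Finset.range k, MvPolynomial.C (coef (j + 1)) * p j)) x =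
        (-1) ^ k * ∫ t in B, (fwdDiff t)^[k] F x * W.eval (‖t‖ ^ 2) := by
      rw [hsum, hfF hx, mul_add, ← mul_assoc, ← mul_pow]
      simp [polyFun]
    rw [heval, abs_mul, abs_pow, abs_neg, abs_one, one_pow, one_mul, ← Real.norm_eq_abs]
    have hbound : ∀ t ∈ B, ‖(fwdDiff t)^[k] F x * W.eval (‖t‖ ^ 2)‖ ≤
        M * (‖t‖ ^ k * W.eval (‖t‖ ^ 2)) := fun t ht => by
      rw [norm_mul, Real.norm_of_nonneg (hW0 t ht), ← mul_assoc]
      exact mul_le_mul_of_nonneg_right (norm_fwdDiff_iter_le hF hM t x) (hW0 t ht)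
    calc _ ≤ ∫ t in B, M * (‖t‖ ^ k * W.eval (‖t‖ ^ 2)) := by
          refine norm_integral_le_of_norm_le ?_
            ((ae_restrict_iff' hBc.measurableSet).2 (ae_of_all _ hbound))
          exact (continuous_const.mul ((continuous_norm.pow k).mul
            hWc)).continuousOn.integrableOn_compact hBc
      _ = M * ∫ t in B, ‖t‖ ^ k * W.eval (‖t‖ ^ 2) := integral_const_mul _ _
      _ ≤ M * (c / (s : ℝ) ^ k) := by gcongr
      _ ≤ (M + 1) * (c / (s : ℝ) ^ k) := by gcongr; linarith
      _ = _ := by ring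

/-! ### Convergence of the Christoffel–Darboux approximants -/

theorem mainTheorem4 {n : ℕ} (X : Set (EuclideanSpace ℝ (Fin n))) (hX : IsCompact X)
    (hvol : 0 < volume X) (k : ℕ) (hk : 0 < k) (f : EuclideanSpace ℝ (Fin n) → ℝ)
    (hf : IsCkOn k f X) :
    ∃ C : ℝ, 0 < C ∧ ∀ s : ℕ, 1 ≤ s →
      ∃ p : MvPolynomial (Fin n) ℝ, p.totalDegree ≤ s ∧
        (∀ x ∈ X, |f x - polyFun p x| ≤ C / (s : ℝ) ^ k) ∧
        ∃ d : ℕ,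
          (∀ x ∈ X, cdArgmax X (polyFun p) d x = {cdApprox X (polyFun p) d x}) ∧
          (∀ x ∈ X, |f x - cdApprox X (polyFun p) d x| ≤ C / (s : ℝ) ^ k) := by
  obtain ⟨C, hC, h⟩ := hf.exists_polyFun_approx hX
  refine ⟨C, hC, fun s hs => ?_⟩
  obtain ⟨p, hpd, hp⟩ := h s hs
  have happ := cdApprox_polyFun hX hvol p hs hpd
  refine ⟨p, hpd, hp, s, fun x _ => ?_, fun x hx => ?_⟩
  · rw [happ, cdArgmax_polyFun hX hvol p hs hpd]
  · rw [happ]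
    exact hp x hx
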